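/- Let $d\ge 2$ and let $S^d$ be the unit sphere of $E^{d+1}$, with spherical distance $|ab|=\arccos\langle a,b\rangle$. A convex body on $S^d$ is a closed set $C\subset S^d$ with non-empty interior that contains no pair of antipodes and contains, with any two points $a,b$, the shorter great-circle arc $ab$. The hemisphere with center $m$ is $H(m)=\{x\in S^d: |xm|\le \pi/2\}$; a hemisphere $K$ supports a convex body $C$ if $C\subset K$ and $\mathrm{bd}(C)\cap\mathrm{bd}(K)\neq\emptyset$. A lune is a set $L=G\cap H$, where $G,H$ are hemispheres that are different and not opposite (their centers are not antipodes); it is bounded by the two $(d-1)$-dimensional hemispheres $G/H=\mathrm{bd}(G)\cap H$ and $H/G=\mathrm{bd}(H)\cap G$, where a $(d-1)$-dimensional hemisphere with center $c$ is the set of points at distance at most $\pi/2$ from $c$ in the intersection of $S^d$ with a $d$-dimensional linear subspace containing $c$. The thickness $\Delta(L)$ is the spherical distance between the centers of $G/H$ and $H/G$. If $K$ supports $C$, the width of $C$ determined by $K$ is the minimum of $\Delta(K\cap K')$ over all hemispheres $K'$ supporting $C$ for which $K\cap K'$ is a lune; $C$ is of constant width $w$ if its width determined by $K$ equals $w$ for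 every hemisphere $K$ supporting $C$. Theorem. For every convex body $W\subset S^d$ of constant width $w$ and every boundary point $p$ of $W$ there exists a lune $L\supset W$ with $\Delta(L)=w$ such that $p$ is the center of one of the two $(d-1)$-dimensional hemispheres bounding $L$. -/

import Mathlib

open scoped Real

namespace SphericalBody

/-- The unit sphere `S^d` of the Euclidean space `E^{d+1}`, with the subspace topology. -/
abbrev Sph (d : ℕ) : Type := Metric.sphere (0 : EuclideanSpace ℝ (Fin (d + 1))) 1

variable {d : ℕ}

/-- The spherical distance `|ab|`: the length of the shorter great-circle arc from `a` to `b`. -/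
noncomputable def sdist (a b : Sph d) : ℝ :=
  InnerProductGeometry.angle (a : EuclideanSpace ℝ (Fin (d + 1))) b

/-- The spherical ball `B_ρ(x)`. -/
def sball (x : Sph d) (ρ : ℝ) : Set (Sph d) := {y | sdist y x ≤ ρ}

/-- The hemisphere `H(m)` with center `m`. -/
def hemisphere (m : Sph d) : Set (Sph d) := sball m (π / 2)

def IsHemisphere (G : Set (Sph d)) : Prop := ∃ m : Sph d, G = hemisphere m

/-- Opposite hemispheres: their centers are a pair of antipodes. -/
def AreOpposite (G H : Set (Sph d)) : Prop :=
  ∃ m : Sph d, G = hemisphere m ∧ H = hemisphere (-m)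

/-- The arc `ab` of two points that are not antipodes: the shorter part of the great circle
through them, that is, the points of the sphere in the cone spanned by `a` and `b`
(for `a = b` it is the single point `a`). -/
def arc (a b : Sph d) : Set (Sph d) :=
  {x | ∃ s t : ℝ, 0 ≤ s ∧ 0 ≤ t ∧
    (x : EuclideanSpace ℝ (Fin (d + 1))) =
      s • (a : EuclideanSpace ℝ (Fin (d + 1))) + t • (b : EuclideanSpace ℝ (Fin (d + 1)))}

/-- Spherical convexity: no pair of antipodes, and closed under connecting arcs. -/
def IsSphConvex (C : Set (Sph d)) : Prop :=
  (∀ a ∈ C, -a ∉ C) ∧ ∀ a ∈ C, ∀ b ∈ C, arc a b ⊆ C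

/-- A convex body: a closed convex set with non-empty interior. -/
def IsConvexBody (C : Set (Sph d)) : Prop :=
  IsClosed C ∧ IsSphConvex C ∧ (interior C).Nonempty

/-- The hemisphere `K` supports `C`. -/
def Supports (K C : Set (Sph d)) : Prop :=
  IsHemisphere K ∧ C ⊆ K ∧ (frontier C ∩ frontier K).Nonempty

/-- `G` and `H` are hemispheres, different and not opposite, so that `G ∩ H` is a lune. -/
def FormLune (G H : Set (Sph d)) : Prop :=
  IsHemisphere G ∧ IsHemisphere H ∧ G ≠ H ∧ ¬ AreOpposite G H

/-- `G/H`: the part of the boundary of the lune `G ∩ H` that lies in the boundary of `G`. -/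
def luneFace (G H : Set (Sph d)) : Set (Sph d) := frontier G ∩ H

/-- `A` is a `(d-1)`-dimensional hemisphere with center `c`: for a `(d-1)`-dimensional great
sphere (the trace of a hyper-subspace `V`) through `c`, it is the set of the points of this
great sphere at distance at most `π/2` from `c`. -/
def IsCenter (c : Sph d) (A : Set (Sph d)) : Prop :=
  ∃ V : Submodule ℝ (EuclideanSpace ℝ (Fin (d + 1))), Module.finrank ℝ V = d ∧
    (c : EuclideanSpace ℝ (Fin (d + 1))) ∈ V ∧
    A = {x : Sph d | (x : EuclideanSpace ℝ (Fin (d + 1))) ∈ V ∧ sdist x c ≤ π / 2}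

/-- The lune `G ∩ H` has thickness `t`: the centers of the two `(d-1)`-dimensional hemispheres
bounding it are at spherical distance `t`. -/
def HasThickness (G H : Set (Sph d)) (t : ℝ) : Prop :=
  ∃ a b : Sph d, IsCenter a (luneFace G H) ∧ IsCenter b (luneFace H G) ∧ sdist a b = t

/-- The width of `C` determined by the hemisphere `K` is `w`: the least thickness of a lune
`K ∩ K'` over the hemispheres `K'` supporting `C`. -/
def HasWidth (K C : Set (Sph d)) (w : ℝ) : Prop :=
  IsLeast {t | ∃ K', Supports K' C ∧ FormLune K K' ∧ HasThickness K K' t} w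

/-- `W` is a (spherical convex) body of constant width `w`. -/
def IsBodyOfConstantWidth (W : Set (Sph d)) (w : ℝ) : Prop :=
  IsConvexBody W ∧ ∀ K, Supports K W → HasWidth K W w

end SphericalBody

/-! Write A for W as a set of unit vectors and D for its dual cone, the vectors m with `0 ≤ minInner
A m`. The centers of the supporting hemispheres are the unit vectors on the boundary of D, and the
lune of centers g, h has thickness π minus the angle between g and h (`hasThickness_iff`). Thus
constant width w means that D has angular diameter π - w and that each boundary direction of D has a
partner in D at that distance.

Put C = cos w, S = sin w. Given p, choose g in D orthogonal to p. The second center must be h = S p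
- C g, the point at distance π - w from g on the great circle through g and p, on the side of p. The
whole task is to show that h lies in D.

If w ≥ π/2, D is complete: it contains every direction within π - w of all its points
(`minInner_nonneg_of_forall_le_inner`). If h were not in D, some x in D would be too far from h.
Pushing g slightly towards x and across the hyperplane orthogonal to p then gives a y still within π
- w of all of D (`exists_le_inner_of_lt`). So y is in D, although its product with p is negative.

If w < π/2, let k be a partner of g in D. First-order optimality puts q = (g + C k) / S in W. Since
W has diameter at most w (`le_inner_of_mem`), comparing p with q forces k = h. -/

namespace SphericalBody

/-! ### Convex cones over compact spherical sets, and duality. -/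

section Cone

open scoped RealInnerProductSpace

variable {E : Type*} [NormedAddCommGroup E] [InnerProductSpace ℝ E]

/-- A compact set of unit vectors, without antipodes, that is the trace on the unit sphere of a
convex cone and spans the space. -/
structure IsConvexTrace (A : Set E) : Prop where
  isCompact : IsCompact A
  nonempty : A.Nonempty
  norm_eq_one : ∀ a ∈ A, ‖a‖ = 1
  add_mem : ∀ a ∈ A, ∀ b ∈ A, ∀ s t : ℝ, 0 ≤ s → 0 ≤ t → ‖s • a + t • b‖ = 1 → s • a + t • b ∈ A
  neg_notMem : ∀ a ∈ A, -a ∉ A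
  eq_zero_of_orthogonal : ∀ m : E, (∀ a ∈ A, ⟪a, m⟫ = 0) → m = 0

/-- The least inner product of `m` with a point of `A`. -/
noncomputable def minInner (A : Set E) (m : E) : ℝ := sInf ((fun a => ⟪a, m⟫) '' A)

/-- The cone of the points whose direction belongs to `A`, together with the origin. -/
def coneOver (A : Set E) : Set E := {y | ∃ a ∈ A, y = ‖y‖ • a}

variable {A : Set E}

namespace IsConvexTrace

theorem exists_minInner_eq (hA : IsConvexTrace A) (m : E) :
    ∃ a ∈ A, minInner A m = ⟪a, m⟫ ∧ ∀ b ∈ A, ⟪a, m⟫ ≤ ⟪b, m⟫ :=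
  hA.isCompact.exists_sInf_image_eq_and_le hA.nonempty (by fun_prop)

theorem minInner_le (hA : IsConvexTrace A) (m : E) {a : E} (ha : a ∈ A) :
    minInner A m ≤ ⟪a, m⟫ := by
  obtain ⟨b, _, h, h'⟩ := hA.exists_minInner_eq m
  exact h ▸ h' a ha

theorem continuous_minInner (hA : IsConvexTrace A) : Continuous (minInner A) :=
  hA.isCompact.continuous_sInf (f := fun m a => ⟪a, m⟫) (by
    change Continuous fun q : E × E => ⟪q.2, q.1⟫
    fun_prop)

theorem minInner_nonneg_iff (hA : IsConvexTrace A) {m : E} :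
    0 ≤ minInner A m ↔ ∀ a ∈ A, 0 ≤ ⟪a, m⟫ := by
  refine ⟨fun h a ha => h.trans (hA.minInner_le m ha), fun h => ?_⟩
  obtain ⟨a, ha, h1, -⟩ := hA.exists_minInner_eq m
  exact h1 ▸ h a ha

theorem minInner_smul (hA : IsConvexTrace A) {t : ℝ} (ht : 0 ≤ t) (m : E) :
    minInner A (t • m) = t * minInner A m := by
  obtain ⟨a, ha, h1, h2⟩ := hA.exists_minInner_eq m
  obtain ⟨b, hb, h3, h4⟩ := hA.exists_minInner_eq (t • m)
  have h5 := h4 a ha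
  have h6 := mul_le_mul_of_nonneg_left (h2 b hb) ht
  rw [inner_smul_right, inner_smul_right] at h5
  rw [inner_smul_right] at h3
  rw [h3, h1]
  linarith

theorem minInner_add_le (hA : IsConvexTrace A) (m n : E) :
    minInner A m + minInner A n ≤ minInner A (m + n) := by
  obtain ⟨a, ha, h1, -⟩ := hA.exists_minInner_eq (m + n)
  rw [h1, inner_add_right]
  exact add_le_add (hA.minInner_le m ha) (hA.minInner_le n ha)

/-- On a segment from a point of the dual cone to a point outside its interior there is a boundary
point. -/
theorem exists_minInner_eq_zero (hA : IsConvexTrace A) {z y : E} (hz : 0 ≤ minInner A z)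
    (hy : minInner A y ≤ 0) :
    ∃ s ∈ Set.Icc (0 : ℝ) 1, minInner A ((1 - s) • z + s • y) = 0 := by
  have hc : ContinuousOn (fun s : ℝ => minInner A ((1 - s) • z + s • y)) (Set.Icc 0 1) :=
    (hA.continuous_minInner.comp (by fun_prop)).continuousOn
  have := intermediate_value_Icc' zero_le_one hc
  exact this ⟨by simpa using hy, by simpa using hz⟩

theorem isClosed_coneOver (hA : IsConvexTrace A) : IsClosed (coneOver A) := by
  have : CompactSpace A := isCompact_iff_compactSpace.mp hA.isCompact
  have h : IsClosed {q : E × A | q.1 = ‖q.1‖ • (q.2 : E)} :=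
    isClosed_eq (by fun_prop) (by fun_prop)
  have h2 := isClosedMap_fst_of_compactSpace _ h
  convert h2 using 1
  ext y
  simp [coneOver]

theorem smul_mem_coneOver (hA : IsConvexTrace A) {t : ℝ} (ht : 0 ≤ t) {a : E} (ha : a ∈ A) :
    t • a ∈ coneOver A :=
  ⟨a, ha, by rw [norm_smul, hA.norm_eq_one a ha, Real.norm_of_nonneg ht, mul_one]⟩

theorem add_mem_coneOver (hA : IsConvexTrace A) {x y : E} (hx : x ∈ coneOver A)
    (hy : y ∈ coneOver A) : x + y ∈ coneOver A := by
  obtain ⟨a, ha, hx⟩ := hx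
  obtain ⟨b, hb, hy⟩ := hy
  by_cases h : x + y = 0
  · exact ⟨a, ha, by simp [h]⟩
  have hn : ‖x + y‖ ≠ 0 := norm_ne_zero_iff.mpr h
  have key : ‖x + y‖⁻¹ • (x + y) = (‖x + y‖⁻¹ * ‖x‖) • a + (‖x + y‖⁻¹ * ‖y‖) • b := by
    rw [mul_smul, mul_smul, ← hx, ← hy, smul_add]
  refine ⟨_, hA.add_mem a ha b hb (‖x + y‖⁻¹ * ‖x‖) (‖x + y‖⁻¹ * ‖y‖) (by positivity)
    (by positivity) ?_, ?_⟩
  · rw [← key, norm_smul, norm_inv, norm_norm, inv_mul_cancel₀ hn]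
  · rw [← key, smul_inv_smul₀ hn]

theorem smul_mem_coneOver' {t : ℝ} (ht : 0 ≤ t) {x : E} (hx : x ∈ coneOver A) :
    t • x ∈ coneOver A := by
  obtain ⟨a, ha, hx⟩ := hx
  refine ⟨a, ha, ?_⟩
  rw [norm_smul, Real.norm_of_nonneg ht, mul_smul, ← hx]

theorem convex_coneOver (hA : IsConvexTrace A) : Convex ℝ (coneOver A) :=
  fun _ hx _ hy _ _ hs ht _ =>
    hA.add_mem_coneOver (smul_mem_coneOver' hs hx) (smul_mem_coneOver' ht hy)

theorem mem_of_mem_coneOver {y : E} (hy : y ∈ coneOver A) (h : ‖y‖ = 1) : y ∈ A := by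
  obtain ⟨a, ha, hy⟩ := hy
  rw [h, one_smul] at hy
  exact hy ▸ ha

theorem subset_coneOver (hA : IsConvexTrace A) : A ⊆ coneOver A := fun a ha => by
  simpa using hA.smul_mem_coneOver zero_le_one ha

variable [CompleteSpace E]

/-- The bipolar theorem. -/
theorem exists_inner_neg (hA : IsConvexTrace A) {y : E} (hy : y ∉ coneOver A) :
    ∃ m, 0 ≤ minInner A m ∧ ⟪y, m⟫ < 0 := by
  have h0 : (0 : E) ∈ coneOver A := by
    obtain ⟨a, ha⟩ := hA.nonempty
    simpa using hA.smul_mem_coneOver le_rfl ha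
  obtain ⟨v, hv, h⟩ := exists_norm_eq_iInf_of_complete_convex ⟨0, h0⟩
    hA.isClosed_coneOver.isComplete hA.convex_coneOver y
  rw [norm_eq_iInf_iff_real_inner_le_zero hA.convex_coneOver hv] at h
  have h1 := h 0 h0
  have h2 := h ((2 : ℝ) • v) (smul_mem_coneOver' zero_le_two hv)
  have h3 : ⟪y - v, v⟫ = 0 := by
    rw [two_smul, add_sub_cancel_right] at h2
    rw [zero_sub, inner_neg_right] at h1
    linarith
  -- The separating normal points from y to its nearest point v in the cone.
  refine ⟨v - y, hA.minInner_nonneg_iff.mpr fun a ha => ?_, ?_⟩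
  · have h4 := h a (hA.subset_coneOver ha)
    rw [inner_sub_right, h3] at h4
    rw [real_inner_comm, ← neg_sub, inner_neg_left]
    linarith
  · have h5 : 0 < ⟪y - v, y - v⟫ :=
      real_inner_self_pos.mpr (sub_ne_zero.mpr fun h => hy (h ▸ hv))
    rw [inner_sub_right, h3] at h5
    rw [real_inner_comm, ← neg_sub, inner_neg_left]
    linarith

theorem mem_of_forall_inner_nonneg (hA : IsConvexTrace A) {y : E} (hy : ‖y‖ = 1)
    (h : ∀ m, 0 ≤ minInner A m → 0 ≤ ⟪y, m⟫) : y ∈ A := by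
  by_contra hn
  obtain ⟨m, hm, hm'⟩ := hA.exists_inner_neg fun h => hn (mem_of_mem_coneOver h hy)
  exact absurd (h m hm) hm'.not_ge

/-- Since -a is outside the cone, the bipolar theorem gives a dual vector positive at a, hence near
a. By compactness, finitely many such vectors suffice, and their sum is positive on all of A. -/
theorem exists_forall_inner_pos (hA : IsConvexTrace A) : ∃ m, ∀ a ∈ A, 0 < ⟪a, m⟫ := by
  suffices ∃ m, 0 ≤ minInner A m ∧ ∀ a ∈ A, a ∈ A → 0 < ⟪a, m⟫ from
    this.imp fun _ h a ha => h.2 a ha ha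
  refine hA.isCompact.induction_on
    (p := fun s => ∃ m, 0 ≤ minInner A m ∧ ∀ a ∈ A, a ∈ s → 0 < ⟪a, m⟫)
    ⟨0, by simp [hA.minInner_nonneg_iff]⟩ ?_ ?_ ?_
  · rintro s t hst ⟨m, hm, h⟩
    exact ⟨m, hm, fun a ha has => h a ha (hst has)⟩
  · rintro s t ⟨m, hm, h⟩ ⟨n, hn, h'⟩
    refine ⟨m + n, (add_nonneg hm hn).trans (hA.minInner_add_le m n), fun a ha hst => ?_⟩
    rw [inner_add_right]
    rcases hst with hs | ht
    · exact add_pos_of_pos_of_nonneg (h a ha hs) (hA.minInner_nonneg_iff.mp hn a ha)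
    · exact add_pos_of_nonneg_of_pos (hA.minInner_nonneg_iff.mp hm a ha) (h' a ha ht)
  · intro a ha
    obtain ⟨m, hm, h⟩ := hA.exists_inner_neg (y := -a) fun h =>
      hA.neg_notMem a ha (mem_of_mem_coneOver h (by rw [norm_neg, hA.norm_eq_one a ha]))
    rw [inner_neg_left, neg_lt_zero] at h
    refine ⟨{b | 0 < ⟪b, m⟫}, mem_nhdsWithin_of_mem_nhds ?_, m, hm, fun _ _ h => h⟩
    exact (isOpen_lt continuous_const (by fun_prop)).mem_nhds h

/-- `A` meets the interior of its dual cone. -/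
theorem exists_mem_minInner_pos (hA : IsConvexTrace A) : ∃ z ∈ A, 0 < minInner A z := by
  obtain ⟨m, hm⟩ := hA.exists_forall_inner_pos
  have hcl : IsClosed (coneOver A ∩ {y | ⟪y, m⟫ = 1}) :=
    hA.isClosed_coneOver.inter (isClosed_eq (by fun_prop) continuous_const)
  have hcv : Convex ℝ (coneOver A ∩ {y | ⟪y, m⟫ = 1}) := by
    refine hA.convex_coneOver.inter fun x hx y hy s t _ _ hst => ?_
    simp only [Set.mem_ofPred_eq] at hx hy ⊢
    rw [inner_add_left, inner_smul_left, inner_smul_left, hx, hy]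
    simpa using hst
  have hray : ∀ a ∈ A, ⟪a, m⟫⁻¹ • a ∈ coneOver A ∩ {y | ⟪y, m⟫ = 1} := fun a ha =>
    ⟨hA.smul_mem_coneOver (inv_nonneg.mpr (hm a ha).le) ha, by
      simp [inner_smul_left, (hm a ha).ne']⟩
  obtain ⟨a₀, ha₀⟩ := hA.nonempty
  obtain ⟨v, hv, h⟩ := exists_norm_eq_iInf_of_complete_convex ⟨_, hray a₀ ha₀⟩
    hcl.isComplete hcv 0
  rw [norm_eq_iInf_iff_real_inner_le_zero hcv hv] at h
  have hv0 : v ≠ 0 := by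
    rintro rfl
    simpa using hv.2
  have hvn : 0 < ‖v‖ := norm_pos_iff.mpr hv0
  obtain ⟨z, hz, hvz⟩ := hv.1
  refine ⟨z, hz, ?_⟩
  obtain ⟨a, ha, h1, -⟩ := hA.exists_minInner_eq z
  rw [h1]
  -- The slice of the cone at height 1 lies beyond the hyperplane through its point v nearest to the
  -- origin, so v has positive product with every ray of the cone; z is the direction of v.
  have h2 := h _ (hray a ha)
  rw [zero_sub, inner_neg_left, inner_sub_right, inner_smul_right, real_inner_self_eq_norm_sq] at h2
  have h3 : 0 < ⟪a, m⟫⁻¹ * ⟪v, a⟫ := by nlinarith [pow_pos hvn 2]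
  have h4 : 0 < ⟪v, a⟫ := pos_of_mul_pos_right h3 (inv_nonneg.mpr (hm a ha).le)
  rw [hvz, inner_smul_left] at h4
  rw [real_inner_comm]
  exact pos_of_mul_pos_right h4 (by simp)

end IsConvexTrace

end Cone

/-! ### Constant width as a diameter property of the dual cone. -/

section ConstantWidth

open scoped RealInnerProductSpace

variable {E : Type*} [NormedAddCommGroup E] [InnerProductSpace ℝ E] {A : Set E} {C S : ℝ}

/-- The dual cone of `A` has the greatest angle `arccos (-C)`, and this angle is attained at each of
its boundary points. -/
structure IsConstantWidth (A : Set E) (C : ℝ) : Prop extends IsConvexTrace A where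
  le_inner : ∀ g h, minInner A g = 0 → minInner A h = 0 → -C * (‖g‖ * ‖h‖) ≤ ⟪g, h⟫
  exists_inner_eq : ∀ g, ‖g‖ = 1 → minInner A g = 0 →
    ∃ h, ‖h‖ = 1 ∧ 0 ≤ minInner A h ∧ ⟪g, h⟫ = -C

/-- Adding a nonnegative multiple of u to a vector does not enlarge its angle with u. -/
theorem le_inner_of_le_inner_sub_smul (hC : |C| ≤ 1) {k u : E} {ε : ℝ} (hε : 0 ≤ ε)
    (h : -C * (‖k - ε • u‖ * ‖u‖) ≤ ⟪k - ε • u, u⟫) : -C * (‖k‖ * ‖u‖) ≤ ⟪k, u⟫ := by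
  rw [inner_sub_left, real_inner_smul_left, real_inner_self_eq_norm_sq] at h
  have h1 : |‖k - ε • u‖ - ‖k‖| ≤ ε * ‖u‖ := by
    have := abs_norm_sub_norm_le (k - ε • u) k
    rwa [sub_sub_cancel_left, norm_neg, norm_smul, Real.norm_of_nonneg hε] at this
  have h2 : C * (‖k - ε • u‖ - ‖k‖) ≤ ε * ‖u‖ := by
    refine (le_abs_self _).trans ?_
    rw [abs_mul]
    nlinarith [abs_nonneg (‖k - ε • u‖ - ‖k‖)]
  nlinarith [mul_le_mul_of_nonneg_right h2 (norm_nonneg u)]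

/-- A ray in direction -k must leave the dual cone: A spans the space, so some point of A has
positive product with k. -/
theorem exists_minInner_sub_smul_eq_zero (hA : IsConvexTrace A) {k k' : E} (hk0 : k ≠ 0)
    (hk : 0 ≤ minInner A k) (hk' : 0 ≤ minInner A k') :
    ∃ ε : ℝ, 0 ≤ ε ∧ minInner A (k' - ε • k) = 0 := by
  obtain ⟨x, hx, hxk⟩ : ∃ x ∈ A, 0 < ⟪x, k⟫ := by
    by_contra! h
    exact hk0 (hA.eq_zero_of_orthogonal k fun a ha =>
      le_antisymm (h a ha) (hA.minInner_nonneg_iff.mp hk a ha))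
  have h0 : minInner A (k' - (⟪x, k'⟫ / ⟪x, k⟫) • k) ≤ 0 := by
    refine (hA.minInner_le _ hx).trans_eq ?_
    rw [inner_sub_right, inner_smul_right, div_mul_cancel₀ _ hxk.ne', sub_self]
  obtain ⟨s, hs, h⟩ := hA.exists_minInner_eq_zero hk' h0
  refine ⟨s * (⟪x, k'⟫ / ⟪x, k⟫), mul_nonneg hs.1
    (div_nonneg (hA.minInner_nonneg_iff.mp hk' x hx) hxk.le), ?_⟩
  rw [← h]
  congr 1
  module

/-- Bessel's inequality for two vectors. -/
theorem inner_sq_add_inner_sq_le {z g p : E} (hz : ‖z‖ = 1) (hg : ‖g‖ = 1) (hp : ‖p‖ = 1)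
    (hpg : ⟪p, g⟫ = 0) : ⟪z, g⟫ ^ 2 + ⟪z, p⟫ ^ 2 ≤ 1 := by
  have h : 0 ≤ ‖z - ⟪z, g⟫ • g - ⟪z, p⟫ • p‖ ^ 2 := sq_nonneg _
  rw [norm_sub_sq_real, norm_sub_sq_real, inner_sub_left] at h
  simp only [norm_smul, real_inner_smul_left, real_inner_smul_right, hz, hg, hp, mul_one,
    Real.norm_eq_abs, sq_abs, real_inner_comm p g, hpg] at h
  nlinarith

/-- By Bessel, a g-component of at least -C ≥ 0 leaves at most S for the p-component of a unit
vector. -/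
theorem inner_le_mul_norm_of_le_inner (hC0 : C ≤ 0) (hS : 0 < S) (hCS : C ^ 2 + S ^ 2 = 1)
    {z g p : E} (hg : ‖g‖ = 1) (hp : ‖p‖ = 1) (hpg : ⟪p, g⟫ = 0) (hzg : -C * ‖z‖ ≤ ⟪z, g⟫) :
    ⟪z, p⟫ ≤ S * ‖z‖ := by
  rcases eq_or_ne z 0 with rfl | hz0
  · simp
  have hzn : 0 < ‖z‖ := norm_pos_iff.mpr hz0
  have hb := inner_sq_add_inner_sq_le (z := ‖z‖⁻¹ • z)
    (by rw [norm_smul, norm_inv, norm_norm, inv_mul_cancel₀ hzn.ne']) hg hp hpg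
  rw [real_inner_smul_left, real_inner_smul_left, inv_mul_eq_div, inv_mul_eq_div] at hb
  rw [← div_le_iff₀ hzn]
  refine le_of_sq_le_sq ?_ hS.le
  have hzg' : -C ≤ ⟪z, g⟫ / ‖z‖ := (le_div_iff₀ hzn).mpr hzg
  have : (-C) ^ 2 ≤ (⟪z, g⟫ / ‖z‖) ^ 2 := pow_le_pow_left₀ (neg_nonneg.mpr hC0) hzg' 2
  linarith

/-- A first-order comparison in t: the linear gain `c * e - σ` absorbs the quadratic term once t is
small, as `hM` expresses. -/
theorem mul_le_sub_of_sq_le {c n t e M σ : ℝ} (hc : 0 < c) (ht : 0 < t)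
    (hn : n ^ 2 ≤ 1 - 2 * t * e + t ^ 2 * M) (hM : t * (c * M) ≤ 2 * (c * e - σ))
    (hσ : 0 ≤ c - t * σ) : c * n ≤ c - t * σ := by
  refine le_of_sq_le_sq ?_ hσ
  have h1 : (c * n) ^ 2 ≤ c ^ 2 * (1 - 2 * t * e + t ^ 2 * M) := by
    rw [mul_pow]
    exact mul_le_mul_of_nonneg_left hn (sq_nonneg c)
  have h2 := mul_le_mul_of_nonneg_left hM (mul_pos ht hc).le
  have h3 := sq_nonneg (t * σ)
  linarith

/-- A point beyond the hyperplane orthogonal to `p`, obtained by perturbing `g` towards `x`. -/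
theorem exists_le_inner_of_lt (hC0 : C ≤ 0) (hS : 0 < S) (hCS : C ^ 2 + S ^ 2 = 1) {p g x : E}
    (hp1 : ‖p‖ = 1) (hg1 : ‖g‖ = 1) (hx1 : ‖x‖ = 1) (hpg : ⟪p, g⟫ = 0) (hpx : 0 ≤ ⟪p, x⟫)
    (hlt : S * ⟪p, x⟫ - C * ⟪g, x⟫ < -C) :
    ∃ y, ⟪p, y⟫ < 0 ∧ ∀ z, -C * ‖z‖ ≤ ⟪z, g⟫ → -C * ‖z‖ ≤ ⟪z, x⟫ →
      -C * ‖z‖ * ‖y‖ ≤ ⟪z, y⟫ := by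
  have hgp : ⟪g, p⟫ = 0 := by rw [real_inner_comm, hpg]
  -- The lower bound on s makes y cross the hyperplane orthogonal to p; the upper bound makes y
  -- shorten, to first order, by enough to pay for the p-term.
  obtain ⟨s, hs1, hs2⟩ : ∃ s, ⟪p, x⟫ < s ∧ S * s < -C * (1 - ⟪g, x⟫) := by
    obtain ⟨s, hs⟩ := exists_between (show ⟪p, x⟫ < -C * (1 - ⟪g, x⟫) / S by
      rw [lt_div_iff₀ hS]; linarith)
    refine ⟨s, hs.1, ?_⟩
    have := (lt_div_iff₀ hS).mp hs.2
    linarith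
  have hgx1 : ⟪g, x⟫ ≤ 1 := by simpa [hg1, hx1] using real_inner_le_norm g x
  have hCneg : C < 0 := by
    refine lt_of_le_of_ne hC0 fun h => ?_
    subst h
    nlinarith
  have hs0 : 0 < s := hpx.trans_lt hs1
  set M := 2 - 2 * ⟪g, x⟫ + s ^ 2 with hM
  have hMpos : 0 < M := by nlinarith [pow_pos hs0 2]
  have hδ : 0 < -C * (1 - ⟪g, x⟫) - S * s := sub_pos.mpr hs2
  -- The bound 1/2 serves only to keep `-C - t * (S * s)` nonnegative (`hsS`); the other bound is
  -- the smallness needed in `mul_le_sub_of_sq_le`.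
  obtain ⟨t, ht0, ht2, htM⟩ : ∃ t : ℝ, 0 < t ∧ t ≤ 1 / 2 ∧
      t * (-C * M) ≤ 2 * (-C * (1 - ⟪g, x⟫) - S * s) := by
    have hCM : 0 < -C * M := mul_pos (neg_pos.mpr hCneg) hMpos
    refine ⟨min (1 / 2) (2 * (-C * (1 - ⟪g, x⟫) - S * s) / (-C * M)),
      lt_min (by norm_num) (div_pos (by linarith) hCM), min_le_left _ _, ?_⟩
    rw [← le_div_iff₀ hCM]
    exact min_le_right _ _
  set y := (1 - t) • g + t • x - (t * s) • p with hy
  have hpy : ⟪p, y⟫ = t * (⟪p, x⟫ - s) := by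
    rw [hy, inner_sub_right, inner_add_right, inner_smul_right, inner_smul_right, inner_smul_right,
      hpg, real_inner_self_eq_norm_sq, hp1]
    ring
  have hpyneg : ⟪p, y⟫ < 0 := by
    rw [hpy]
    exact mul_neg_of_pos_of_neg ht0 (sub_neg.mpr hs1)
  have hy2 : ‖y‖ ^ 2 ≤ 1 - 2 * t * (1 - ⟪g, x⟫) + t ^ 2 * M := by
    have : ‖y‖ ^ 2 = (1 - t) ^ 2 + t ^ 2 + t ^ 2 * s ^ 2 + 2 * (t * (1 - t)) * ⟪g, x⟫
        - 2 * (t ^ 2 * s) * ⟪p, x⟫ := by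
      rw [hy, norm_sub_sq_real, norm_add_sq_real, inner_add_left]
      simp only [norm_smul, real_inner_smul_left, real_inner_smul_right, hp1, hg1, hx1, mul_one,
        Real.norm_eq_abs, sq_abs, hgp, real_inner_comm p x]
      ring
    have h2 : 0 ≤ (t ^ 2 * s) * ⟪p, x⟫ := by positivity
    rw [this, hM]
    nlinarith
  have hgx0 : -1 ≤ ⟪g, x⟫ := by
    have := abs_le.mp (abs_real_inner_le_norm g x)
    rw [hg1, hx1] at this
    linarith
  have hsS : t * (S * s) ≤ -C := by
    have h1 : t * (S * s) ≤ 1 / 2 * (S * s) := mul_le_mul_of_nonneg_right ht2 (mul_pos hS hs0).le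
    have h2 : -C * (1 - ⟪g, x⟫) ≤ -C * 2 :=
      mul_le_mul_of_nonneg_left (by linarith) (neg_pos.mpr hCneg).le
    linarith
  have hynorm : -C * ‖y‖ ≤ -C - t * (S * s) :=
    mul_le_sub_of_sq_le (neg_pos.mpr hCneg) ht0 hy2 htM (sub_nonneg.mpr hsS)
  refine ⟨y, hpyneg, fun z hzg hzx => ?_⟩
  have hzp := inner_le_mul_norm_of_le_inner hC0 hS hCS hg1 hp1 hpg hzg
  have hzy : ⟪z, y⟫ = (1 - t) * ⟪z, g⟫ + t * ⟪z, x⟫ - (t * s) * ⟪z, p⟫ := by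
    rw [hy, inner_sub_right, inner_add_right, inner_smul_right, inner_smul_right,
      inner_smul_right]
  rw [hzy]
  have h1 := mul_le_mul_of_nonneg_left hzg (show 0 ≤ 1 - t by linarith)
  have h2 := mul_le_mul_of_nonneg_left hzx ht0.le
  have h3 := mul_le_mul_of_nonneg_left hzp (mul_pos ht0 hs0).le
  have h4 := mul_le_mul_of_nonneg_right hynorm (norm_nonneg z)
  linarith

namespace IsConstantWidth

/-- The diameter bound passes from the boundary of the dual cone to all of it: push each vector away
from the other until it reaches the boundary, which only widens the angle. -/
theorem le_inner_of_nonneg (hA : IsConstantWidth A C) (hC : |C| ≤ 1) {k k' : E}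
    (hk : 0 ≤ minInner A k) (hk' : 0 ≤ minInner A k') : -C * (‖k‖ * ‖k'‖) ≤ ⟪k, k'⟫ := by
  rcases eq_or_ne k 0 with rfl | hk0
  · simp
  obtain ⟨ε, hε, hu⟩ := exists_minInner_sub_smul_eq_zero hA.toIsConvexTrace hk0 hk hk'
  rw [real_inner_comm, mul_comm ‖k‖]
  apply le_inner_of_le_inner_sub_smul hC hε
  rw [real_inner_comm, mul_comm ‖k' - ε • k‖]
  rcases eq_or_ne (k' - ε • k) 0 with h0 | hu0
  · simp [h0]
  obtain ⟨ε', hε', hu'⟩ := exists_minInner_sub_smul_eq_zero hA.toIsConvexTrace hu0 hu.ge hk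
  exact le_inner_of_le_inner_sub_smul hC hε' (hA.le_inner _ _ hu' hu)

variable [CompleteSpace E]

/-- The dual cone is complete: it contains every point within the diameter of all its points. -/
theorem minInner_nonneg_of_forall_le_inner (hA : IsConstantWidth A C) (hC : |C| ≤ 1) (hC0 : C ≤ 0)
    {y : E} (hy : ‖y‖ = 1) (h : ∀ x, 0 ≤ minInner A x → -C * ‖x‖ ≤ ⟪x, y⟫) :
    0 ≤ minInner A y := by
  by_contra! hy0
  obtain ⟨z, hz, hzpos⟩ := hA.exists_mem_minInner_pos
  have hz1 := hA.norm_eq_one z hz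
  have hzy : -C ≤ ⟪z, y⟫ := by simpa [hz1] using h z hzpos.le
  obtain ⟨s, hs, hu⟩ := hA.exists_minInner_eq_zero hzpos.le hy0.le
  set u := (1 - s) • z + s • y with hudef
  have hs1 : s < 1 := by
    refine lt_of_le_of_ne hs.2 fun h1 => hy0.ne ?_
    simpa [hudef, h1] using hu
  have hs0 : 0 < s := by
    refine lt_of_le_of_ne hs.1 fun h1 => hzpos.ne ?_
    simpa [hudef, ← h1] using hu.symm
  have hu2 : ‖u‖ ^ 2 = 1 - 2 * s * (1 - s) * (1 - ⟪z, y⟫) := by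
    rw [hudef, norm_add_sq_real, norm_smul, norm_smul, hz1, hy, inner_smul_left, inner_smul_right,
      Real.norm_of_nonneg hs0.le, Real.norm_of_nonneg (sub_nonneg.mpr hs.2)]
    simp only [conj_trivial]
    ring
  have hu0 : 0 < ‖u‖ := by
    refine norm_pos_iff.mpr fun h0 => ?_
    rw [h0] at hu2
    simp only [norm_zero] at hu2
    nlinarith [sq_nonneg (1 - 2 * s), mul_pos hs0 (sub_pos.mpr hs1)]
  have hzy1 : ⟪z, y⟫ < 1 := by
    refine inner_lt_one_iff_real_of_norm_eq_one hz1 hy |>.mpr ?_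
    rintro rfl
    exact hy0.not_gt hzpos
  have hu1 : ‖u‖ < 1 := by
    have := mul_pos (mul_pos hs0 (sub_pos.mpr hs1)) (sub_pos.mpr hzy1)
    nlinarith
  -- The partner k of the boundary direction u is within the diameter of both z and y. As u is a
  -- proper convex combination of them with norm below 1, this contradicts the extremality of k.
  obtain ⟨k, hk1, hk, hgk⟩ := hA.exists_inner_eq (‖u‖⁻¹ • u)
    (by rw [norm_smul, norm_inv, norm_norm, inv_mul_cancel₀ hu0.ne'])
    (by rw [hA.minInner_smul (by positivity), hu, mul_zero])
  have huk : ⟪u, k⟫ = -C * ‖u‖ := by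
    rw [real_inner_smul_left] at hgk
    field_simp at hgk
    linarith
  have hky : -C ≤ ⟪y, k⟫ := by
    rw [real_inner_comm]
    simpa [hk1] using h k hk
  have huk' : ⟪u, k⟫ = (1 - s) * ⟪z, k⟫ + s * ⟪y, k⟫ := by
    rw [hudef, inner_add_left, real_inner_smul_left, real_inner_smul_left]
  have hzk : -C ≤ ⟪z, k⟫ := by
    simpa [hz1, hk1] using hA.le_inner_of_nonneg hC hzpos.le hk
  rcases hC0.lt_or_eq with hneg | rfl
  · nlinarith
  · -- perturb `z` away from `k`
    have hzk0 : 0 < ⟪z, k⟫ := by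
      obtain ⟨ε, hε, hv⟩ := exists_minInner_sub_smul_eq_zero hA.toIsConvexTrace
        (norm_ne_zero_iff.mp (by simp [hk1])) hk hzpos.le
      have hv2 := hA.le_inner_of_nonneg hC hv.ge hk
      rw [inner_sub_left, real_inner_smul_left, real_inner_self_eq_norm_sq, hk1] at hv2
      have : 0 < ε := by
        refine lt_of_le_of_ne hε fun h0 => hzpos.ne ?_
        simpa [← h0] using hv.symm
      linarith
    nlinarith [mul_pos (sub_pos.mpr hs1) hzk0]

/-- The far boundary point of the lune when the width is at least `π / 2`. -/
theorem minInner_sub_nonneg_of_nonpos (hA : IsConstantWidth A C) (hC0 : C ≤ 0) (hS : 0 < S)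
    (hCS : C ^ 2 + S ^ 2 = 1) {p g : E} (hp : p ∈ A) (hg1 : ‖g‖ = 1) (hg : 0 ≤ minInner A g)
    (hpg : ⟪p, g⟫ = 0) : 0 ≤ minInner A (S • p - C • g) := by
  have hC : |C| ≤ 1 := abs_le_one_iff_mul_self_le_one.mpr (by nlinarith)
  have hp1 := hA.norm_eq_one p hp
  have hh1 : ‖S • p - C • g‖ = 1 := by
    have : ‖S • p - C • g‖ ^ 2 = 1 := by
      rw [norm_sub_sq_real, norm_smul, norm_smul, hp1, hg1, inner_smul_left, inner_smul_right, hpg,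
        mul_one, mul_one, Real.norm_eq_abs, Real.norm_eq_abs, sq_abs, sq_abs]
      linarith
    exact (pow_eq_one_iff_of_nonneg (norm_nonneg _) two_ne_zero).mp this
  suffices H : ∀ x, ‖x‖ = 1 → 0 ≤ minInner A x → -C ≤ S * ⟪p, x⟫ - C * ⟪g, x⟫ by
    refine hA.minInner_nonneg_of_forall_le_inner hC hC0 hh1 fun x hx => ?_
    rcases eq_or_ne x 0 with rfl | hx0
    · simp
    have hxn : 0 < ‖x‖ := norm_pos_iff.mpr hx0
    have := H (‖x‖⁻¹ • x) (by rw [norm_smul, norm_inv, norm_norm, inv_mul_cancel₀ hxn.ne'])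
      (by rw [hA.minInner_smul (by positivity)]; positivity)
    rw [real_inner_comm, inner_sub_left, real_inner_smul_left, real_inner_smul_left]
    rw [inner_smul_right, inner_smul_right] at this
    field_simp at this
    linarith
  -- A point x too far from the candidate would let completeness add to the dual cone a direction y
  -- with negative product with p.
  intro x hx1 hx
  by_contra! hlt
  obtain ⟨y, hpyneg, hyz⟩ := exists_le_inner_of_lt hC0 hS hCS hp1 hg1 hx1 hpg
    (hA.minInner_nonneg_iff.mp hx p hp) hlt
  have hyn : 0 < ‖y‖ := norm_pos_iff.mpr fun h0 => by simp [h0] at hpyneg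
  refine hpyneg.not_ge ?_
  have hyD : 0 ≤ minInner A (‖y‖⁻¹ • y) := by
    refine hA.minInner_nonneg_of_forall_le_inner hC hC0
      (by rw [norm_smul, norm_inv, norm_norm, inv_mul_cancel₀ hyn.ne']) fun z hz => ?_
    rw [inner_smul_right, inv_mul_eq_div, le_div_iff₀ hyn]
    refine hyz z ?_ ?_
    · simpa [hg1] using hA.le_inner_of_nonneg hC hz hg
    · simpa [hx1] using hA.le_inner_of_nonneg hC hz hx
  have := hA.minInner_nonneg_iff.mp hyD p hp
  rw [inner_smul_right] at this
  exact nonneg_of_mul_nonneg_right this (by positivity)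

/-- Otherwise the arc from an interior point z of the dual cone to b contains a boundary direction g
of the dual cone, with g in A. Its partner has product -C < 0 with g, yet it is nonnegative on A. -/
theorem inner_pos_of_pos (hA : IsConstantWidth A C) (hC0 : 0 < C) {a b : E} (ha : a ∈ A)
    (hb : b ∈ A) : 0 < ⟪a, b⟫ := by
  by_contra! hab
  obtain ⟨z, hz, hzpos⟩ := hA.exists_mem_minInner_pos
  obtain ⟨s, hs, hu⟩ := hA.exists_minInner_eq_zero hzpos.le ((hA.minInner_le b ha).trans hab)
  have huA : (1 - s) • z + s • b ∈ coneOver A :=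
    hA.add_mem_coneOver (hA.smul_mem_coneOver (sub_nonneg.mpr hs.2) hz)
      (hA.smul_mem_coneOver hs.1 hb)
  have hu0 : (1 - s) • z + s • b ≠ 0 := by
    intro h0
    have h1 := hA.minInner_le z hz
    have h2 := hA.minInner_le z hb
    have h3 : (1 - s) * ⟪z, z⟫ + s * ⟪b, z⟫ = 0 := by
      rw [← real_inner_smul_left, ← real_inner_smul_left, ← inner_add_left, h0, inner_zero_left]
    have h4 := mul_le_mul_of_nonneg_left h1 (sub_nonneg.mpr hs.2)
    have h5 := mul_le_mul_of_nonneg_left h2 hs.1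
    linarith
  obtain ⟨g, hg, hug⟩ := huA
  have hun : 0 < ‖(1 - s) • z + s • b‖ := norm_pos_iff.mpr hu0
  have hg0 : minInner A g = 0 := by
    rw [hug, hA.minInner_smul (norm_nonneg _)] at hu
    exact (mul_eq_zero.mp hu).resolve_left hun.ne'
  obtain ⟨h, -, hh, hgh⟩ := hA.exists_inner_eq g (hA.norm_eq_one g hg) hg0
  have := hA.minInner_nonneg_iff.mp hh g hg
  linarith

/-- If the width is less than `π / 2`, then it bounds the diameter. -/
theorem le_inner_of_mem (hA : IsConstantWidth A C) (hC0 : 0 < C) (hS : 0 < S)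
    (hCS : C ^ 2 + S ^ 2 = 1) {a b : E} (ha : a ∈ A) (hb : b ∈ A) : C ≤ ⟪a, b⟫ := by
  obtain ⟨⟨p, q⟩, ⟨hp, hq⟩, hmin⟩ := (hA.isCompact.prod hA.isCompact).exists_isMinOn
    (hA.nonempty.prod hA.nonempty) (f := fun x : E × E => ⟪x.1, x.2⟫) (by fun_prop)
  have hmin' : ∀ x ∈ A, ∀ y ∈ A, ⟪p, q⟫ ≤ ⟪x, y⟫ := fun x hx y hy =>
    isMinOn_iff.mp hmin (x, y) ⟨hx, hy⟩
  refine le_trans ?_ (hmin' a ha b hb)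
  have hp1 := hA.norm_eq_one p hp
  have hq1 := hA.norm_eq_one q hq
  have hc0 := hA.inner_pos_of_pos hC0 hp hq
  by_contra! hcC
  set c := ⟪p, q⟫ with hc
  have hqp : ⟪q, p⟫ = c := real_inner_comm p q
  have hpp : ⟪p, p⟫ = 1 := by rw [real_inner_self_eq_norm_sq, hp1, one_pow]
  have hr2 : ‖q - c • p‖ ^ 2 = 1 - c ^ 2 := by
    rw [norm_sub_sq_real, norm_smul, real_inner_smul_right, hp1, hq1, hqp, mul_one,
      Real.norm_eq_abs, sq_abs]
    ring
  have hr0 : 0 < ‖q - c • p‖ := by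
    refine (sq_pos_iff.mp ?_).lt_of_le' (norm_nonneg _)
    rw [hr2]
    nlinarith
  set r := ‖q - c • p‖ with hr
  -- For a diametral pair p, q, this is the tangent at p towards q; by minimality of c > 0 it lies
  -- in the dual cone. The partner of g, being nonnegative on q, then bounds c from below.
  set g := r⁻¹ • (q - c • p) with hg
  have hg1 : ‖g‖ = 1 := by
    rw [hg, norm_smul, norm_inv, Real.norm_of_nonneg hr0.le, inv_mul_cancel₀ hr0.ne']
  have hpg : ⟪p, g⟫ = 0 := by
    rw [hg, inner_smul_right, inner_sub_right, inner_smul_right, hpp, ← hc]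
    ring
  have hg0 : minInner A g = 0 := by
    refine le_antisymm ((hA.minInner_le g hp).trans_eq hpg) ?_
    refine hA.minInner_nonneg_iff.mpr fun x hx => ?_
    rw [hg, inner_smul_right, inner_sub_right, inner_smul_right]
    have h1 := hmin' x hx q hq
    have h2 : ⟪x, p⟫ ≤ 1 := by
      simpa [hp1, hA.norm_eq_one x hx] using real_inner_le_norm x p
    refine mul_nonneg (inv_nonneg.mpr hr0.le) ?_
    nlinarith
  obtain ⟨h, hh1, hh, hgh⟩ := hA.exists_inner_eq g hg1 hg0
  have hqh := hA.minInner_nonneg_iff.mp hh q hq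
  have hqe : q = c • p + r • g := by
    rw [hg, smul_inv_smul₀ hr0.ne']
    abel
  have hqh' : ⟪q, h⟫ = c * ⟪p, h⟫ - r * C := by
    rw [hqe, inner_add_left, real_inner_smul_left, real_inner_smul_left, hgh]
    ring
  have hb := inner_sq_add_inner_sq_le hh1 hg1 hp1 hpg
  rw [real_inner_comm, hgh, real_inner_comm] at hb
  have hph : ⟪p, h⟫ ≤ S := le_of_sq_le_sq (by nlinarith) hS.le
  have h1 : r * C ≤ c * S := by nlinarith
  have h2 : (r * C) ^ 2 ≤ (c * S) ^ 2 := by gcongr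
  rw [mul_pow, mul_pow, hr2] at h2
  nlinarith

/-- The far boundary point of the lune when the width is less than `π / 2`. -/
theorem minInner_sub_nonneg_of_pos (hA : IsConstantWidth A C) (hC0 : 0 < C) (hS : 0 < S)
    (hCS : C ^ 2 + S ^ 2 = 1) {p g : E} (hp : p ∈ A) (hg1 : ‖g‖ = 1) (hg : 0 ≤ minInner A g)
    (hpg : ⟪p, g⟫ = 0) : 0 ≤ minInner A (S • p - C • g) := by
  have hC : |C| ≤ 1 := abs_le_one_iff_mul_self_le_one.mpr (by nlinarith)
  have hp1 := hA.norm_eq_one p hp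
  obtain ⟨h, hh1, hh, hgh⟩ := hA.exists_inner_eq g hg1
    (le_antisymm ((hA.minInner_le g hp).trans_eq hpg) hg)
  have hgg : ⟪g, g⟫ = 1 := by rw [real_inner_self_eq_norm_sq, hg1, one_pow]
  have hhh : ⟪h, h⟫ = 1 := by rw [real_inner_self_eq_norm_sq, hh1, one_pow]
  have hpp : ⟪p, p⟫ = 1 := by rw [real_inner_self_eq_norm_sq, hp1, one_pow]
  have hq1 : ‖S⁻¹ • (g + C • h)‖ = 1 := by
    have h1 : ‖g + C • h‖ = S := by
      refine (pow_left_inj₀ (norm_nonneg _) hS.le two_ne_zero).mp ?_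
      rw [norm_add_sq_real, norm_smul, inner_smul_right, hgh, hg1, hh1, mul_one, Real.norm_eq_abs,
        sq_abs]
      linarith
    rw [norm_smul, h1, norm_inv, Real.norm_of_nonneg hS.le, inv_mul_cancel₀ hS.ne']
  have hq : S⁻¹ • (g + C • h) ∈ A := by
    refine hA.mem_of_forall_inner_nonneg hq1 fun y hy => ?_
    rw [real_inner_smul_left, inner_add_left, real_inner_smul_left]
    refine mul_nonneg (inv_nonneg.mpr hS.le) ?_
    -- Since h is at greatest distance from g, moving it towards any dual y cannot increase that
    -- distance; letting ε tend to 0 gives the first-order condition.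
    have key : ∀ ε : ℝ, 0 < ε → -(C * ‖y‖ ^ 2 / 2 * ε) ≤ ⟪g, y⟫ + C * ⟪h, y⟫ := by
      intro ε hε
      have h1 := hA.le_inner_of_nonneg hC hg (k' := h + ε • y) <| by
        refine (add_nonneg hh ?_).trans (hA.minInner_add_le _ _)
        rw [hA.minInner_smul hε.le]
        positivity
      rw [hg1, one_mul, inner_add_right, inner_smul_right, hgh] at h1
      have h2 : ‖h + ε • y‖ ≤ 1 + ε * ⟪h, y⟫ + ε ^ 2 * ‖y‖ ^ 2 / 2 := by
        have h3 : ‖h + ε • y‖ ^ 2 = 1 + 2 * ε * ⟪h, y⟫ + ε ^ 2 * ‖y‖ ^ 2 := by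
          rw [norm_add_sq_real, norm_smul, inner_smul_right, hh1, mul_pow, Real.norm_eq_abs, sq_abs]
          ring
        nlinarith [sq_nonneg (‖h + ε • y‖ - 1)]
      have h4 := mul_le_mul_of_nonneg_left h2 hC0.le
      have h5 : ε * -(C * ‖y‖ ^ 2 / 2 * ε) ≤ ε * (⟪g, y⟫ + C * ⟪h, y⟫) := by nlinarith
      exact le_of_mul_le_mul_left h5 hε
    have hlim : Filter.Tendsto (fun ε : ℝ => -(C * ‖y‖ ^ 2 / 2 * ε)) (nhdsWithin 0 (Set.Ioi 0))
        (nhds 0) := by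
      refine (Continuous.tendsto' (by fun_prop) _ _ (by simp)).mono_left nhdsWithin_le_nhds
    exact le_of_tendsto hlim (eventually_mem_nhdsWithin.mono key)
  have hpq := hA.le_inner_of_mem hC0 hS hCS hp hq
  rw [inner_smul_right, inner_add_right, inner_smul_right, hpg, zero_add, inv_mul_eq_div,
    le_div_iff₀ hS] at hpq
  have hph : S ≤ ⟪p, h⟫ := le_of_mul_le_mul_left hpq hC0
  -- The product of h with g is -C and with p at least S, so the unit vectors h and `S • p - C • g`
  -- have product at least 1.
  have heq : h - (S • p - C • g) = 0 := by
    rw [← norm_eq_zero, ← sq_eq_zero_iff]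
    refine le_antisymm ?_ (sq_nonneg _)
    rw [← real_inner_self_eq_norm_sq]
    simp only [inner_sub_left, inner_sub_right, real_inner_smul_left, real_inner_smul_right, hpp,
      hgg, hhh, hpg, hgh, real_inner_comm p g, real_inner_comm p h, real_inner_comm g h]
    nlinarith
  rwa [← sub_eq_zero.mp heq]

/-- The far boundary point of the lune. -/
theorem minInner_sub_nonneg (hA : IsConstantWidth A C) (hS : 0 < S)
    (hCS : C ^ 2 + S ^ 2 = 1) {p g : E} (hp : p ∈ A) (hg1 : ‖g‖ = 1) (hg : 0 ≤ minInner A g)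
    (hpg : ⟪p, g⟫ = 0) : 0 ≤ minInner A (S • p - C • g) :=
  (le_or_gt C 0).elim (fun h => hA.minInner_sub_nonneg_of_nonpos h hS hCS hp hg1 hg hpg)
    fun h => hA.minInner_sub_nonneg_of_pos h hS hCS hp hg1 hg hpg

end IsConstantWidth

end ConstantWidth

/-! ### Hemispheres, lunes and their thickness in terms of centers. -/

variable {d : ℕ}

open scoped RealInnerProductSpace

local notation "𝔼" d => EuclideanSpace ℝ (Fin (d + 1))

theorem norm_coe (x : Sph d) : ‖(x : 𝔼 d)‖ = 1 := norm_eq_of_mem_sphere x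

theorem sdist_le_iff (x y : Sph d) : sdist x y ≤ π / 2 ↔ 0 ≤ ⟪(x : 𝔼 d), y⟫ := by
  rw [sdist, InnerProductGeometry.angle, norm_coe, norm_coe, mul_one, div_one,
    Real.arccos_le_pi_div_two]

theorem sdist_eq_arccos (x y : Sph d) : sdist x y = Real.arccos ⟪(x : 𝔼 d), y⟫ := by
  rw [sdist, InnerProductGeometry.angle, norm_coe, norm_coe, mul_one, div_one]

theorem mem_hemisphere {x m : Sph d} : x ∈ hemisphere m ↔ 0 ≤ ⟪(x : 𝔼 d), m⟫ := sdist_le_iff x m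

/-- The direction of a nonzero vector. -/
noncomputable def direction (v : 𝔼 d) (hv : v ≠ 0) : Sph d :=
  ⟨‖v‖⁻¹ • v, by
    rw [mem_sphere_zero_iff_norm, norm_smul, norm_inv, norm_norm,
      inv_mul_cancel₀ (norm_ne_zero_iff.mpr hv)]⟩

theorem coe_direction (v : 𝔼 d) (hv : v ≠ 0) : (direction v hv : 𝔼 d) = ‖v‖⁻¹ • v := rfl

theorem inner_direction_nonneg_iff (v u : 𝔼 d) (hv : v ≠ 0) :
    0 ≤ ⟪(direction v hv : 𝔼 d), u⟫ ↔ 0 ≤ ⟪v, u⟫ := by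
  rw [coe_direction, real_inner_smul_left]
  exact mul_nonneg_iff_of_pos_left (inv_pos.mpr (norm_pos_iff.mpr hv))

theorem inner_direction_eq_zero_iff (v u : 𝔼 d) (hv : v ≠ 0) :
    ⟪(direction v hv : 𝔼 d), u⟫ = 0 ↔ ⟪v, u⟫ = 0 := by
  rw [coe_direction, real_inner_smul_left, mul_eq_zero]
  exact or_iff_right (inv_ne_zero (norm_ne_zero_iff.mpr hv))

/-- A hemisphere determines its center: for m ≠ n, the direction of m - n separates the two
hemispheres. -/
theorem eq_of_inner_nonneg_imp {m n : Sph d}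
    (h : ((m : 𝔼 d) - n ≠ 0) → 0 ≤ ⟪(m : 𝔼 d) - n, (n : 𝔼 d)⟫) : m = n := by
  by_contra hne
  have hne' : (m : 𝔼 d) ≠ n := fun h => hne (Subtype.ext h)
  have h1 := h (sub_ne_zero.mpr hne')
  rw [inner_sub_left, real_inner_self_eq_norm_sq, norm_coe] at h1
  have h2 := (inner_lt_one_iff_real_of_norm_eq_one (norm_coe m) (norm_coe n)).mpr hne'
  linarith

theorem hemisphere_injective : Function.Injective (hemisphere : Sph d → Set (Sph d)) := by
  intro m n h
  refine eq_of_inner_nonneg_imp fun h0 => ?_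
  rw [← inner_direction_nonneg_iff _ _ h0, ← mem_hemisphere, ← h, mem_hemisphere,
    inner_direction_nonneg_iff, inner_sub_left, real_inner_self_eq_norm_sq, norm_coe]
  have : ⟪(n : 𝔼 d), m⟫ ≤ 1 := by simpa using real_inner_le_norm (n : 𝔼 d) m
  linarith

theorem formLune_iff {g h : Sph d} :
    FormLune (hemisphere g) (hemisphere h) ↔ g ≠ h ∧ g ≠ -h := by
  refine ⟨fun ⟨_, _, h1, h2⟩ => ⟨fun e => h1 (by rw [e]), fun e => h2 ⟨g, rfl, by simp [e]⟩⟩,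
    fun ⟨h1, h2⟩ => ⟨⟨g, rfl⟩, ⟨h, rfl⟩, hemisphere_injective.ne h1, ?_⟩⟩
  rintro ⟨m, hm, hm'⟩
  apply h2
  rw [hemisphere_injective hm, hemisphere_injective hm', neg_neg]

/-- Near `x` there are points of the sphere on the negative side of a great sphere through `x`. -/
theorem exists_inner_neg_of_mem_interior {x n : Sph d} {U : Set (Sph d)} (hx : x ∈ interior U)
    (hxn : ⟪(x : 𝔼 d), n⟫ = 0) : ∃ y ∈ U, ⟪(y : 𝔼 d), n⟫ < 0 := by
  have hmem : ∀ t : ℝ, Real.cos t • (x : 𝔼 d) - Real.sin t • (n : 𝔼 d) ∈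
      Metric.sphere (0 : 𝔼 d) 1 := fun t => by
    have : ‖Real.cos t • (x : 𝔼 d) - Real.sin t • (n : 𝔼 d)‖ ^ 2 = 1 := by
      rw [norm_sub_sq_real, norm_smul, norm_smul, real_inner_smul_left, real_inner_smul_right, hxn,
        norm_coe, norm_coe, mul_one, mul_one, Real.norm_eq_abs, Real.norm_eq_abs, sq_abs, sq_abs]
      linarith [Real.sin_sq_add_cos_sq t]
    rw [mem_sphere_zero_iff_norm]
    exact (pow_eq_one_iff_of_nonneg (norm_nonneg _) two_ne_zero).mp this
  let γ : ℝ → Sph d := fun t => ⟨_, hmem t⟩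
  have hγ : Continuous γ := Continuous.subtype_mk (by fun_prop) _
  have hγ0 : γ 0 = x := Subtype.ext (by simp [γ])
  have h1 : ∀ᶠ t in nhds 0, γ t ∈ U :=
    hγ.continuousAt.eventually_mem (hγ0 ▸ mem_interior_iff_mem_nhds.mp hx)
  have h2 : ∀ᶠ t in nhdsWithin (0 : ℝ) (Set.Ioi 0), γ t ∈ U := h1.filter_mono nhdsWithin_le_nhds
  obtain ⟨t, htU, ht⟩ := (h2.and (Ioo_mem_nhdsGT Real.pi_pos)).exists
  refine ⟨γ t, htU, ?_⟩
  change ⟪Real.cos t • (x : 𝔼 d) - Real.sin t • (n : 𝔼 d), (n : 𝔼 d)⟫ < 0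
  rw [inner_sub_left, real_inner_smul_left, real_inner_smul_left, hxn, real_inner_self_eq_norm_sq,
    norm_coe]
  have := Real.sin_pos_of_pos_of_lt_pi ht.1 ht.2
  linarith

theorem isClosed_hemisphere (m : Sph d) : IsClosed (hemisphere m) := by
  have : hemisphere m = {x : Sph d | 0 ≤ ⟪(x : 𝔼 d), m⟫} := Set.ext fun _ => mem_hemisphere
  rw [this]
  exact isClosed_le continuous_const (by fun_prop)

theorem mem_frontier_hemisphere {x m : Sph d} :
    x ∈ frontier (hemisphere m) ↔ ⟪(x : 𝔼 d), m⟫ = 0 := by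
  rw [(isClosed_hemisphere m).frontier_eq, Set.mem_sdiff, mem_hemisphere]
  constructor
  · rintro ⟨h1, h2⟩
    refine le_antisymm (not_lt.mp fun h3 => h2 ?_) h1
    have ho : IsOpen {x : Sph d | 0 < ⟪(x : 𝔼 d), m⟫} := isOpen_lt continuous_const (by fun_prop)
    exact interior_maximal (fun y hy => mem_hemisphere.mpr (le_of_lt hy)) ho h3
  · intro h
    refine ⟨h.ge, fun hi => ?_⟩
    obtain ⟨y, hy, hy'⟩ := exists_inner_neg_of_mem_interior hi h
    exact hy'.not_ge (mem_hemisphere.mp hy)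

theorem mem_luneFace {x g h : Sph d} :
    x ∈ luneFace (hemisphere g) (hemisphere h) ↔ ⟪(x : 𝔼 d), g⟫ = 0 ∧ 0 ≤ ⟪(x : 𝔼 d), h⟫ := by
  rw [luneFace, Set.mem_inter_iff, mem_frontier_hemisphere, mem_hemisphere]

theorem finrank_orthogonal_coe (g : Sph d) : Module.finrank ℝ (ℝ ∙ (g : 𝔼 d))ᗮ = d := by
  have : Fact (Module.finrank ℝ (𝔼 d) = d + 1) := ⟨by simp⟩
  exact Submodule.finrank_orthogonal_span_singleton (ne_zero_of_mem_unit_sphere g)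

theorem isCenter_luneFace {g h c : Sph d} {α β : ℝ} (hβ : 0 < β) (hcg : ⟪(c : 𝔼 d), g⟫ = 0)
    (hh : (h : 𝔼 d) = α • (g : 𝔼 d) + β • (c : 𝔼 d)) :
    IsCenter c (luneFace (hemisphere g) (hemisphere h)) := by
  refine ⟨(ℝ ∙ (g : 𝔼 d))ᗮ, finrank_orthogonal_coe g, ?_, Set.ext fun x => ?_⟩
  · rw [Submodule.mem_orthogonal_singleton_iff_inner_left, hcg]
  · simp only [mem_luneFace, Set.mem_ofPred_eq, Submodule.mem_orthogonal_singleton_iff_inner_left,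
      sdist_le_iff]
    refine and_congr_right fun hxg => ?_
    rw [hh, inner_add_right, inner_smul_right, inner_smul_right, hxg, mul_zero, zero_add]
    exact mul_nonneg_iff_of_pos_left hβ

/-- The center of a face is unique, so thickness is well defined: the face spans its subspace V,
which has the dimension of the orthogonal complement of g and hence equals it. -/
theorem IsCenter.eq_of_luneFace {g h c b : Sph d} {α β : ℝ} (hβ : 0 < β)
    (hcg : ⟪(c : 𝔼 d), g⟫ = 0) (hh : (h : 𝔼 d) = α • (g : 𝔼 d) + β • (c : 𝔼 d))
    (hb : IsCenter b (luneFace (hemisphere g) (hemisphere h))) : b = c := by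
  obtain ⟨V, hV, hbV, hface⟩ := hb
  have hmem : ∀ x : Sph d, ((x : 𝔼 d) ∈ V ∧ 0 ≤ ⟪(x : 𝔼 d), b⟫) ↔
      (⟪(x : 𝔼 d), g⟫ = 0 ∧ 0 ≤ ⟪(x : 𝔼 d), c⟫) := fun x => by
    rw [← sdist_le_iff]
    change x ∈ {x : Sph d | (x : 𝔼 d) ∈ V ∧ sdist x b ≤ π / 2} ↔ _
    rw [← hface, mem_luneFace]
    refine and_congr_right fun hxg => ?_
    rw [hh, inner_add_right, inner_smul_right, inner_smul_right, hxg, mul_zero, zero_add]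
    exact mul_nonneg_iff_of_pos_left hβ
  have hVle : V ≤ (ℝ ∙ (g : 𝔼 d))ᗮ := by
    intro v hv
    rw [Submodule.mem_orthogonal_singleton_iff_inner_left]
    -- One of v and -v points into the half of V that forms the face.
    wlog hvb : 0 ≤ ⟪v, (b : 𝔼 d)⟫ generalizing v
    · have := this (V.neg_mem hv) (by rw [inner_neg_left]; linarith)
      rwa [inner_neg_left, neg_eq_zero] at this
    rcases eq_or_ne v 0 with rfl | hv0
    · simp
    rw [← inner_direction_eq_zero_iff _ _ hv0]
    exact ((hmem (direction v hv0)).mp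
      ⟨V.smul_mem _ hv, (inner_direction_nonneg_iff _ _ hv0).mpr hvb⟩).1
  have hVeq : V = (ℝ ∙ (g : 𝔼 d))ᗮ :=
    Submodule.eq_of_le_of_finrank_eq hVle (by rw [hV, finrank_orthogonal_coe])
  have hbg : ⟪(b : 𝔼 d), g⟫ = 0 := by
    rw [← Submodule.mem_orthogonal_singleton_iff_inner_left]
    exact hVle hbV
  refine (eq_of_inner_nonneg_imp fun h0 => ?_).symm
  rw [← inner_direction_nonneg_iff _ _ h0]
  refine ((hmem _).mpr ⟨?_, ?_⟩).2
  · rw [inner_direction_eq_zero_iff, inner_sub_left, hcg, hbg, sub_zero]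
  · rw [inner_direction_nonneg_iff, inner_sub_left, real_inner_self_eq_norm_sq, norm_coe]
    have : ⟪(b : 𝔼 d), c⟫ ≤ 1 := by simpa using real_inner_le_norm (b : 𝔼 d) c
    linarith

theorem abs_inner_lt_one {g h : Sph d} (h1 : g ≠ h) (h2 : g ≠ -h) : |⟪(g : 𝔼 d), h⟫| < 1 := by
  have h3 := (inner_lt_one_iff_real_of_norm_eq_one (norm_coe g) (norm_coe h)).mpr
    fun e => h1 (Subtype.ext e)
  have h4 := (inner_lt_one_iff_real_of_norm_eq_one (norm_coe g) (norm_coe (-h))).mpr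
    fun e => h2 (Subtype.ext e)
  have h5 : ((-h : Sph d) : 𝔼 d) = -(h : 𝔼 d) := rfl
  rw [h5, inner_neg_right] at h4
  exact abs_lt.mpr ⟨by linarith, h3⟩

theorem exists_face_center {g h : Sph d} (h1 : g ≠ h) (h2 : g ≠ -h) :
    ∃ c : Sph d, ⟪(c : 𝔼 d), g⟫ = 0 ∧
      (h : 𝔼 d) = ⟪(g : 𝔼 d), h⟫ • (g : 𝔼 d) + √(1 - ⟪(g : 𝔼 d), h⟫ ^ 2) • (c : 𝔼 d) := by
  have hlt := abs_inner_lt_one h1 h2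
  set α := ⟪(g : 𝔼 d), h⟫ with hα
  have hpos : 0 < 1 - α ^ 2 := sub_pos.mpr ((sq_lt_one_iff_abs_lt_one α).mpr hlt)
  have hn : ‖(h : 𝔼 d) - α • (g : 𝔼 d)‖ = √(1 - α ^ 2) := by
    symm
    rw [Real.sqrt_eq_iff_eq_sq hpos.le (norm_nonneg _), norm_sub_sq_real, norm_smul,
      real_inner_smul_right, real_inner_comm, ← hα, norm_coe, norm_coe, mul_one, Real.norm_eq_abs,
      sq_abs]
    ring
  have h0 : (h : 𝔼 d) - α • (g : 𝔼 d) ≠ 0 := by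
    rw [← norm_ne_zero_iff, hn]
    exact (Real.sqrt_pos.mpr hpos).ne'
  refine ⟨direction _ h0, ?_, ?_⟩
  · rw [inner_direction_eq_zero_iff, inner_sub_left, real_inner_smul_left,
      real_inner_self_eq_norm_sq, norm_coe, real_inner_comm, ← hα]
    ring
  · rw [coe_direction, ← hn, smul_inv_smul₀ (norm_ne_zero_iff.mpr h0), add_sub_cancel]

theorem hasThickness_iff {g h : Sph d} {t : ℝ} (h1 : g ≠ h) (h2 : g ≠ -h) :
    HasThickness (hemisphere g) (hemisphere h) t ↔ t = Real.arccos (-⟪(g : 𝔼 d), h⟫) := by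
  obtain ⟨a, hag, hh⟩ := exists_face_center h1 h2
  obtain ⟨b, hbh, hg⟩ := exists_face_center h1.symm (fun e => h2 (by rw [e, neg_neg]))
  rw [real_inner_comm] at hg
  have hlt := abs_inner_lt_one h1 h2
  set α := ⟪(g : 𝔼 d), h⟫ with hα
  have hpos : 0 < 1 - α ^ 2 := sub_pos.mpr ((sq_lt_one_iff_abs_lt_one α).mpr hlt)
  have hβ := Real.sqrt_pos.mpr hpos
  have hβ2 := Real.sq_sqrt hpos.le
  set β := √(1 - α ^ 2)
  have hab : sdist a b = Real.arccos (-α) := by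
    rw [sdist_eq_arccos]
    congr 1
    have e1 : ⟪(a : 𝔼 d), h⟫ = β := by
      rw [hh, inner_add_right, inner_smul_right, inner_smul_right, hag, real_inner_self_eq_norm_sq,
        norm_coe]
      ring
    have e2 : ⟪(a : 𝔼 d), g⟫ = α * β + β * ⟪(a : 𝔼 d), b⟫ := by
      rw [hg, inner_add_right, inner_smul_right, inner_smul_right, e1]
    rw [hag] at e2
    have e3 : β * (α + ⟪(a : 𝔼 d), b⟫) = 0 := by linarith
    linarith [(mul_eq_zero.mp e3).resolve_left hβ.ne']
  constructor
  · rintro ⟨a', b', ha', hb', rfl⟩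
    rw [ha'.eq_of_luneFace hβ hag hh, hb'.eq_of_luneFace hβ hbh hg, hab]
  · rintro rfl
    exact ⟨a, b, isCenter_luneFace hβ hag hh, isCenter_luneFace hβ hbh hg, hab⟩

/-! ### From spherical bodies to dual cones, and the lune at p. -/

/-- The unit vectors of the points of a subset of the sphere. -/
def trace (W : Set (Sph d)) : Set (𝔼 d) := Subtype.val '' W

theorem coe_mem_trace {W : Set (Sph d)} {x : Sph d} : (x : 𝔼 d) ∈ trace W ↔ x ∈ W :=
  Subtype.val_injective.mem_set_image

theorem IsConvexBody.isConvexTrace {W : Set (Sph d)} (hW : IsConvexBody W) :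
    IsConvexTrace (trace W) where
  isCompact := hW.1.isCompact.image continuous_subtype_val
  nonempty := (hW.2.2.mono interior_subset).image _
  norm_eq_one := by
    rintro _ ⟨a, -, rfl⟩
    exact norm_coe a
  add_mem := by
    rintro _ ⟨a, ha, rfl⟩ _ ⟨b, hb, rfl⟩ s t hs ht h
    exact ⟨⟨_, mem_sphere_zero_iff_norm.mpr h⟩, hW.2.1.2 a ha b hb ⟨s, t, hs, ht, rfl⟩, rfl⟩
  neg_notMem := by
    rintro _ ⟨a, ha, rfl⟩ h
    exact hW.2.1.1 a ha (coe_mem_trace.mp h)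
  eq_zero_of_orthogonal := by
    intro m hm
    by_contra h0
    obtain ⟨x, hx⟩ := hW.2.2
    have hz : ∀ y ∈ W, ⟪(y : 𝔼 d), (direction m h0 : 𝔼 d)⟫ = 0 := fun y hy => by
      rw [real_inner_comm, inner_direction_eq_zero_iff, real_inner_comm]
      exact hm _ ⟨y, hy, rfl⟩
    obtain ⟨y, hy, hy'⟩ := exists_inner_neg_of_mem_interior hx (hz x (interior_subset hx))
    exact hy'.ne (hz y hy)

theorem subset_hemisphere_iff {W : Set (Sph d)} (hW : IsConvexBody W) {k : Sph d} :
    W ⊆ hemisphere k ↔ 0 ≤ minInner (trace W) (k : 𝔼 d) := by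
  rw [hW.isConvexTrace.minInner_nonneg_iff]
  simp [trace, Set.subset_def, mem_hemisphere]

theorem supports_iff {W : Set (Sph d)} (hW : IsConvexBody W) {k : Sph d} :
    Supports (hemisphere k) W ↔ minInner (trace W) (k : 𝔼 d) = 0 := by
  constructor
  · rintro ⟨-, hk, x, hx, hxk⟩
    refine le_antisymm ?_ ((subset_hemisphere_iff hW).mp hk)
    rw [← mem_frontier_hemisphere.mp hxk]
    exact hW.isConvexTrace.minInner_le _ ⟨x, hW.1.frontier_subset hx, rfl⟩
  · intro h
    have hk := (subset_hemisphere_iff hW).mpr h.ge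
    obtain ⟨_, ⟨x, hx, rfl⟩, hxk, -⟩ := hW.isConvexTrace.exists_minInner_eq (k : 𝔼 d)
    have hxk' : x ∈ frontier (hemisphere k) := mem_frontier_hemisphere.mpr (by rw [← hxk, h])
    refine ⟨⟨k, rfl⟩, hk, x, ⟨subset_closure hx, fun hi => hxk'.2 (interior_mono hk hi)⟩, hxk'⟩

/-- If p were positive on all unit vectors of the dual cone, a compact set, so would be all nearby
points; by the bipolar theorem these lie in W, making p interior. -/
theorem exists_supporting_hemisphere {W : Set (Sph d)} (hW : IsConvexBody W) {p : Sph d}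
    (hp : p ∈ frontier W) :
    ∃ g : Sph d, 0 ≤ minInner (trace W) (g : 𝔼 d) ∧ ⟪(p : 𝔼 d), g⟫ = 0 := by
  have hA := hW.isConvexTrace
  have hpW : (p : 𝔼 d) ∈ trace W := ⟨p, hW.1.frontier_subset hp, rfl⟩
  by_contra! hne
  refine hp.2 (mem_interior_iff_mem_nhds.mpr ?_)
  have hcl : IsClosed {g : Sph d | 0 ≤ minInner (trace W) (g : 𝔼 d)} :=
    isClosed_le continuous_const (hA.continuous_minInner.comp continuous_subtype_val)
  have hev : ∀ᶠ q : Sph d in nhds p, ∀ g ∈ {g : Sph d | 0 ≤ minInner (trace W) (g : 𝔼 d)},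
      0 < ⟪(q : 𝔼 d), g⟫ := by
    refine hcl.isCompact.eventually_forall_of_forall_eventually fun g hg => ?_
    have ho : IsOpen {z : Sph d × Sph d | 0 < ⟪(z.1 : 𝔼 d), (z.2 : 𝔼 d)⟫} :=
      isOpen_lt continuous_const (by fun_prop)
    exact ho.mem_nhds (x := (p, g)) (lt_of_le_of_ne (hA.minInner_nonneg_iff.mp hg _ hpW) (hne g hg).symm)
  filter_upwards [hev] with q hq
  refine coe_mem_trace.mp (hA.mem_of_forall_inner_nonneg (norm_coe q) fun m hm => ?_)
  rcases eq_or_ne m 0 with rfl | h0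
  · simp
  rw [real_inner_comm, ← inner_direction_nonneg_iff _ _ h0, real_inner_comm]
  refine (hq _ ?_).le
  change 0 ≤ minInner (trace W) (‖m‖⁻¹ • m)
  rw [hA.minInner_smul (by positivity)]
  positivity

theorem HasWidth.exists_center {W : Set (Sph d)} {w : ℝ} (hW : IsConvexBody W) {g : Sph d}
    (h : HasWidth (hemisphere g) W w) : ∃ k : Sph d, g ≠ k ∧ g ≠ -k ∧
      minInner (trace W) (k : 𝔼 d) = 0 ∧ w = Real.arccos (-⟪(g : 𝔼 d), k⟫) := by
  obtain ⟨K, hK, hl, ht⟩ := h.1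
  obtain ⟨k, rfl⟩ := hK.1
  obtain ⟨h1, h2⟩ := formLune_iff.mp hl
  exact ⟨k, h1, h2, (supports_iff hW).mp hK, (hasThickness_iff h1 h2).mp ht⟩

theorem IsBodyOfConstantWidth.le_inner {W : Set (Sph d)} {w : ℝ}
    (hW : IsBodyOfConstantWidth W w) (hw0 : 0 ≤ w) {g h : Sph d}
    (hg : minInner (trace W) (g : 𝔼 d) = 0) (hh : minInner (trace W) (h : 𝔼 d) = 0) :
    -Real.cos w ≤ ⟪(g : 𝔼 d), h⟫ := by
  have hA := hW.1.isConvexTrace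
  by_cases h1 : g = h
  · rw [h1, real_inner_self_eq_norm_sq, norm_coe]
    linarith [Real.neg_one_le_cos w]
  -- Opposite supporting hemispheres would confine W to a great sphere, which has empty interior.
  by_cases h2 : g = -h
  · have h3 : (g : 𝔼 d) = -(h : 𝔼 d) := by rw [h2]; rfl
    refine absurd (hA.eq_zero_of_orthogonal (h : 𝔼 d) fun a ha => ?_)
      (ne_zero_of_mem_unit_sphere h)
    have h4 := hA.minInner_nonneg_iff.mp hg.ge a ha
    rw [h3, inner_neg_right] at h4
    exact le_antisymm (by linarith) (hA.minInner_nonneg_iff.mp hh.ge a ha)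
  have hle : w ≤ Real.arccos (-⟪(g : 𝔼 d), h⟫) :=
    (hW.2 _ ((supports_iff hW.1).mpr hg)).2 ⟨_, (supports_iff hW.1).mpr hh,
      formLune_iff.mpr ⟨h1, h2⟩, (hasThickness_iff h1 h2).mpr rfl⟩
  have hab := abs_lt.mp (abs_inner_lt_one h1 h2)
  have := Real.cos_le_cos_of_nonneg_of_le_pi hw0 (Real.arccos_le_pi _) hle
  rw [Real.cos_arccos (by linarith) (by linarith)] at this
  linarith

theorem cos_arccos_neg_inner (g h : Sph d) :
    Real.cos (Real.arccos (-⟪(g : 𝔼 d), h⟫)) = -⟪(g : 𝔼 d), h⟫ := by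
  have := abs_le.mp (abs_real_inner_le_norm (g : 𝔼 d) h)
  rw [norm_coe, norm_coe] at this
  exact Real.cos_arccos (by linarith) (by linarith)

theorem IsBodyOfConstantWidth.isConstantWidth {W : Set (Sph d)} {w : ℝ}
    (hW : IsBodyOfConstantWidth W w) (hw0 : 0 ≤ w) :
    IsConstantWidth (trace W) (Real.cos w) where
  toIsConvexTrace := hW.1.isConvexTrace
  le_inner g h hg hh := by
    have hA := hW.1.isConvexTrace
    rcases eq_or_ne g 0 with rfl | hg0
    · simp
    rcases eq_or_ne h 0 with rfl | hh0
    · simp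
    have hdir : ∀ (v : 𝔼 d) (hv : v ≠ 0), minInner (trace W) v = 0 →
        minInner (trace W) (direction v hv : 𝔼 d) = 0 := fun v hv h => by
      rw [coe_direction, hA.minInner_smul (by positivity), h, mul_zero]
    have := hW.le_inner hw0 (hdir g hg0 hg) (hdir h hh0 hh)
    rw [coe_direction, coe_direction, real_inner_smul_left, real_inner_smul_right] at this
    have hgn := norm_pos_iff.mpr hg0
    have hhn := norm_pos_iff.mpr hh0
    rw [← mul_assoc, ← mul_inv, inv_mul_eq_div, le_div_iff₀ (mul_pos hgn hhn)] at this
    exact this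
  exists_inner_eq g hg1 hg := by
    obtain ⟨k, -, -, hk, hwk⟩ := HasWidth.exists_center hW.1
      (hW.2 _ ((supports_iff hW.1 (k := ⟨g, mem_sphere_zero_iff_norm.mpr hg1⟩)).mpr hg))
    refine ⟨k, norm_coe k, hk.ge, ?_⟩
    rw [hwk, cos_arccos_neg_inner, neg_neg]

theorem IsBodyOfConstantWidth.exists_lune {W : Set (Sph d)} {w : ℝ}
    (hW : IsBodyOfConstantWidth W w) {p : Sph d} (hp : p ∈ frontier W) :
    ∃ g h : Sph d, FormLune (hemisphere g) (hemisphere h) ∧ W ⊆ hemisphere g ∩ hemisphere h ∧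
      HasThickness (hemisphere g) (hemisphere h) w ∧
      IsCenter p (luneFace (hemisphere g) (hemisphere h)) := by
  have hpW := hW.1.1.frontier_subset hp
  obtain ⟨g, hg, hpg⟩ := exists_supporting_hemisphere hW.1 hp
  have hpA := coe_mem_trace.mpr hpW
  have hg0 : minInner (trace W) (g : 𝔼 d) = 0 :=
    le_antisymm ((hW.1.isConvexTrace.minInner_le _ hpA).trans_eq hpg) hg
  obtain ⟨k, hk1, hk2, -, hwk⟩ :=
    HasWidth.exists_center hW.1 (hW.2 _ ((supports_iff hW.1).mpr hg0))
  have hw0 : 0 ≤ w := hwk ▸ Real.arccos_nonneg _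
  have hwπ : w ≤ π := hwk ▸ Real.arccos_le_pi _
  have hcos : |Real.cos w| < 1 := by
    rw [hwk, cos_arccos_neg_inner, abs_neg]
    exact abs_inner_lt_one hk1 hk2
  have hS : 0 < Real.sin w := by
    refine lt_of_le_of_ne (Real.sin_nonneg_of_nonneg_of_le_pi hw0 hwπ) fun h0 => ?_
    have h1 := (sq_lt_one_iff_abs_lt_one _).mpr hcos
    have h2 := Real.sin_sq_add_cos_sq w
    rw [← h0] at h2
    linarith
  -- The second center is -cos w times g plus sin w times p; as sin w > 0, p is the center of the
  -- face in the boundary of the hemisphere of g.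
  have hh := (hW.isConstantWidth hw0).minInner_sub_nonneg hS (Real.cos_sq_add_sin_sq w) hpA
    (norm_coe g) hg hpg
  set h₀ := Real.sin w • (p : 𝔼 d) -
    Real.cos w • (g : 𝔼 d) with hh₀
  have hn : ‖h₀‖ = 1 := by
    have : ‖h₀‖ ^ 2 = 1 := by
      rw [hh₀, norm_sub_sq_real, norm_smul, norm_smul, real_inner_smul_left, real_inner_smul_right,
        hpg, norm_coe, norm_coe, mul_one, mul_one, Real.norm_eq_abs, Real.norm_eq_abs, sq_abs,
        sq_abs]
      linarith [Real.sin_sq_add_cos_sq w]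
    exact (pow_eq_one_iff_of_nonneg (norm_nonneg _) two_ne_zero).mp this
  let h : Sph d := ⟨h₀, mem_sphere_zero_iff_norm.mpr hn⟩
  have hgh : ⟪(g : 𝔼 d), h⟫ = -Real.cos w := by
    change ⟪(g : 𝔼 d), h₀⟫ = _
    rw [hh₀, inner_sub_right, real_inner_smul_right, real_inner_smul_right, real_inner_comm, hpg,
      real_inner_self_eq_norm_sq, norm_coe]
    ring
  have h1 : g ≠ h := fun e => by
    rw [← e, real_inner_self_eq_norm_sq, norm_coe] at hgh
    linarith [(abs_lt.mp hcos).1]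
  have h2 : g ≠ -h := fun e => by
    have e' : (h : 𝔼 d) = -g := by rw [e]; simp
    rw [e', inner_neg_right, real_inner_self_eq_norm_sq, norm_coe] at hgh
    linarith [(abs_lt.mp hcos).2]
  refine ⟨g, h, formLune_iff.mpr ⟨h1, h2⟩, Set.subset_inter
    ((subset_hemisphere_iff hW.1).mpr hg) ((subset_hemisphere_iff hW.1).mpr hh),
    (hasThickness_iff h1 h2).mpr ?_, isCenter_luneFace (α := -Real.cos w) hS hpg ?_⟩
  · rw [hgh, neg_neg, Real.arccos_cos hw0 hwπ]
  · change h₀ = _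
    rw [hh₀, neg_smul]
    abel

end SphericalBody

theorem mainTheorem4 (d : ℕ) (hd : 2 ≤ d) (W : Set (SphericalBody.Sph d)) (w : ℝ)
    (hW : SphericalBody.IsBodyOfConstantWidth W w)
    (p : SphericalBody.Sph d) (hp : p ∈ frontier W) :
    ∃ G H : Set (SphericalBody.Sph d),
      SphericalBody.FormLune G H ∧ W ⊆ G ∩ H ∧ SphericalBody.HasThickness G H w ∧
        (SphericalBody.IsCenter p (SphericalBody.luneFace G H) ∨
          SphericalBody.IsCenter p (SphericalBody.luneFace H G)) := by
  obtain ⟨g, h, hl, hsub, ht, hc⟩ := hW.exists_lune hp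
  exact ⟨_, _, hl, hsub, ht, Or.inl hc⟩
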